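/- Let $(M,d)$ be a locally compact separable metric space and $\mu$ a Radon measure on $M$ with full support; write $B(x,r)$ for the open ball, $V(x,r)=\mu(B(x,r))$, and $a\wedge b=\min\{a,b\}$. A non-decreasing function $\Psi:(0,\infty)\to(0,\infty)$ satisfies the weak scaling property with $(a_1,a_2)$, where $0<a_1\le a_2<\infty$, if there are constants $c_1,c_2>0$ with $$c_1 (R/r)^{a_1}\le \Psi(R)/\Psi(r)\le c_2 (R/r)^{a_2}\qquad\text{for all } 0<r\le R .$$ Assume the following. (a) The functions $V(x,\cdot)$, $x\in M$, satisfy the weak scaling property with $(d_1,d_2)$, where $0<d_1\le d_2<\infty$, with constants $c_1,c_2$ independent of $x$. (b) $S=\{S_t\}_{t\ge 0}$ is a subordinator (a non-decreasing real-valued Lévy process with $S_0=0$) without drift and with Laplace exponent $\phi$; that is, $\mathbb E e^{-\lambda S_t}=e^{-t\phi(\lambda)}$ for $t,\lambda>0$ and $\phi(\lambda)=\int_0^\infty(1-e^{-\lambda s})\,\nu(ds)$ for a Borel measure $\nu$ on $(0,\infty)$ with $\int_0^\infty(1\wedge s)\,\nu(ds)<\infty$. Moreover $\phi$ satisfies the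 weak scaling property with $(\beta_1,\beta_2)$, where $0<\beta_1\le\beta_2<1$. (c) $\Phi:[0,\infty)\to[0,\infty)$ is strictly increasing, $\Phi(0)=0$, and $\Phi$ satisfies the weak scaling property with $(\alpha_1,\alpha_2)$, where $0<\alpha_1\le\alpha_2<\infty$; put $\Phi^{-1}(r)=\inf\{s>0:\Phi(s)\ge r\}$. (d) $X$ is a strong Markov process on $M$ with infinite lifetime that has a transition density function $q(t,x,y)$ with respect to $\mu$, and there are constants $C_1,C_2>0$ such that for all $t>0$ and $x,y\in M$ $$C_1\Big(\frac1{V(x,\Phi^{-1}(t))}\wedge\frac{t}{V(x,d(x,y))\,\Phi(d(x,y))}\Big)\le q(t,x,y)\le C_2\Big(\frac1{V(x,\Phi^{-1}(t))}\wedge\frac{t}{V(x,d(x,y))\,\Phi(d(x,y))}\Big),$$ where the second term of the minimum is $+\infty$ for $x=y$. For $t>0$ and $x,y\in M$ let $$p(t,x,y)=\int_0^\infty q(r,x,y)\,d_r\mathbb P(S_r\ge t)\in[0,\infty].$$ Then there are constants $c_1,c_2,c_3,c_4>0$ such that the following hold for all $t>0$ and $x,y\in M$. (i) If $\Phi(d(x,y))\,\phi(t^{-1})\le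 1$, then $c_1\,I(t,x,y)\le p(t,x,y)\le c_2\,I(t,x,y)$, where $$I(t,x,y)=\phi(t^{-1})\int_{\Phi(d(x,y))}^{2/\phi(t^{-1})}\frac{dr}{V(x,\Phi^{-1}(r))}=\int_{\Phi(d(x,y))\phi(t^{-1})}^{2}\frac{dr}{V(x,\Phi^{-1}(r/\phi(t^{-1})))}.$$ (For $x=y$ both $p$ and $I$ may be $+\infty$.) (ii) If $\Phi(d(x,y))\,\phi(t^{-1})\ge 1$, then $$\frac{c_3}{\phi(t^{-1})\,V(x,d(x,y))\,\Phi(d(x,y))}\le p(t,x,y)\le \frac{c_4}{\phi(t^{-1})\,V(x,d(x,y))\,\Phi(d(x,y))}.$$ -/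

import Mathlib

open MeasureTheory ProbabilityTheory Set Filter Topology
open scoped NNReal ENNReal

namespace TimeFractional

/-- A non-decreasing function `Ψ : (0,∞) → (0,∞)` satisfies
`c₁ (R/r)^a₁ ≤ Ψ(R)/Ψ(r) ≤ c₂ (R/r)^a₂` for all `0 < r ≤ R`. -/
structure WeakScalingWith (Ψ : ℝ → ℝ) (a₁ a₂ c₁ c₂ : ℝ) : Prop where
  pos : ∀ r, 0 < r → 0 < Ψ r
  mono : MonotoneOn Ψ (Ioi 0)
  lower : ∀ r R, 0 < r → r ≤ R → c₁ * (R / r) ^ a₁ ≤ Ψ R / Ψ r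
  upper : ∀ r R, 0 < r → r ≤ R → Ψ R / Ψ r ≤ c₂ * (R / r) ^ a₂

/-- A family of functions satisfies the weak scaling property uniformly with `(a₁, a₂)`. -/
def UniformWeakScaling {Λ : Type*} (Ψ : Λ → ℝ → ℝ) (a₁ a₂ : ℝ) : Prop :=
  0 < a₁ ∧ a₁ ≤ a₂ ∧
    ∃ c₁ c₂ : ℝ, 0 < c₁ ∧ 0 < c₂ ∧ ∀ x, WeakScalingWith (Ψ x) a₁ a₂ c₁ c₂

/-- The weak scaling property with `(a₁, a₂)`. -/
def WeakScaling (Ψ : ℝ → ℝ) (a₁ a₂ : ℝ) : Prop :=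
  0 < a₁ ∧ a₁ ≤ a₂ ∧ ∃ c₁ c₂ : ℝ, 0 < c₁ ∧ 0 < c₂ ∧ WeakScalingWith Ψ a₁ a₂ c₁ c₂

/-- The inverse `Ψ⁻¹(r) = inf {s > 0 : Ψ(s) ≥ r}` of an increasing function (which need not be
continuous). -/
noncomputable def incInv (Ψ : ℝ → ℝ) (r : ℝ) : ℝ := sInf {s | 0 < s ∧ r ≤ Ψ s}

/-- The volume `V(x,r) = μ(B(x,r))`. -/
noncomputable def vol {M : Type*} [PseudoMetricSpace M] [MeasurableSpace M] (μ : Measure M)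
    (x : M) (r : ℝ) : ℝ≥0∞ := μ (Metric.ball x r)

/-- A subordinator: a real-valued Lévy process started at `0` with non-decreasing
right-continuous paths (left limits exist by monotonicity). -/
structure IsSubordinator {Ω : Type*} [MeasurableSpace Ω] (S : ℝ≥0 → Ω → ℝ) (P : Measure Ω) :
    Prop where
  measurable : ∀ t, Measurable (S t)
  zero : ∀ᵐ ω ∂P, S 0 ω = 0
  mono : ∀ᵐ ω ∂P, Monotone fun t => S t ω
  rightCont : ∀ᵐ ω ∂P, ∀ t, ContinuousWithinAt (fun s => S s ω) (Ici t) t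
  indep : HasIndepIncrements S P
  stationary : ∀ s t, IdentDistrib (fun ω => S (s + t) ω - S s ω) (S t) P P

/-- `φ` is the Laplace exponent of `S`: `E exp(-l S_t) = exp(-t φ(l))`. -/
def IsLaplaceExponent {Ω : Type*} [MeasurableSpace Ω] (S : ℝ≥0 → Ω → ℝ) (P : Measure Ω)
    (φ : ℝ → ℝ) : Prop :=
  ∀ (t : ℝ≥0) (l : ℝ), 0 < l → ∫ ω, Real.exp (-(l * S t ω)) ∂P = Real.exp (-(t * φ l))

/-- `ν` is a Lévy measure on `(0,∞)` with `∫ (1 ∧ s) ν(ds) < ∞`, and `φ` is the exponent without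
drift (and without killing) that it determines, `φ(l) = ∫ (1 - exp(-l s)) ν(ds)`. -/
structure IsDriftlessExponent (φ : ℝ → ℝ) (ν : Measure ℝ) : Prop where
  support : ν (Iic 0) = 0
  finite : ∫⁻ s, ENNReal.ofReal (min 1 s) ∂ν < ∞
  eq : ∀ l, 0 < l → φ l = ∫ s, (1 - Real.exp (-(l * s))) ∂ν

namespace IsSubordinator

variable {Ω : Type*} [MeasurableSpace Ω] {S : ℝ≥0 → Ω → ℝ} {P : Measure Ω}

/-- The non-decreasing right-continuous function `r ↦ P(S_r ≥ t)` (equal to `P(S_0 ≥ t)` for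
`r ≤ 0`). -/
noncomputable def tailFunction [IsProbabilityMeasure P] (hS : IsSubordinator S P) (t : ℝ) :
    StieltjesFunction ℝ where
  toFun r := P.real {ω | t ≤ S r.toNNReal ω}
  mono' := by
    intro r s hrs
    refine ENNReal.toReal_mono (measure_ne_top _ _) (measure_mono_ae ?_)
    filter_upwards [hS.mono] with ω hω h
    exact le_trans h (hω (Real.toNNReal_mono hrs))
  right_continuous' := by
    intro r
    have hm : ∀ s : ℝ, MeasurableSet {ω | t ≤ S s.toNNReal ω} := fun s =>
      measurableSet_le measurable_const (hS.measurable _)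
    refine (ENNReal.tendsto_toReal (measure_ne_top _ _)).comp
      (tendsto_measure_of_ae_tendsto_indicator_of_isFiniteMeasure _ (hm r) hm ?_)
    filter_upwards [hS.mono, hS.rightCont] with ω h1 h2
    by_cases h : t ≤ S r.toNNReal ω
    · filter_upwards [self_mem_nhdsWithin] with s hs
      exact iff_of_true (le_trans h (h1 (Real.toNNReal_mono hs))) h
    · have hc : Tendsto (fun s : ℝ => S s.toNNReal ω) (𝓝[≥] r) (𝓝 (S r.toNNReal ω)) :=
        (h2 r.toNNReal).tendsto.comp
          (continuous_real_toNNReal.continuousWithinAt.tendsto_nhdsWithin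
            fun s hs => Real.toNNReal_mono hs)
      filter_upwards [hc.eventually_lt_const (not_le.1 h)] with s hs
      exact iff_of_false (not_le.2 hs) h

/-- `p(t,x,y) = ∫_0^∞ q(r,x,y) d_r P(S_r ≥ t)`, as an integral with values in `[0,∞]`. -/
noncomputable def fundamentalSolution [IsProbabilityMeasure P] (hS : IsSubordinator S P)
    {M : Type*} (q : ℝ → M → M → ℝ≥0∞) (t : ℝ) (x y : M) : ℝ≥0∞ :=
  ∫⁻ r in Ioi 0, q r x y ∂(hS.tailFunction t).measure

end IsSubordinator

/-- A strong Markov process `X` with values in `M` and infinite lifetime: a process adapted to the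
filtration `ℱ`, with a family of probability laws `P x` under which `X` starts at `x`, such that
for every stopping time `τ` the position `X_τ` is `ℱ_τ`-measurable on `{τ < ∞}` and
`P_x(X_{τ+s} ∈ A | ℱ_τ) = P_{X_τ}(X_s ∈ A)` on `{τ < ∞}`. -/
structure IsStrongMarkov {M Ω : Type*} [MeasurableSpace M] {mΩ : MeasurableSpace Ω}
    (ℱ : Filtration ℝ≥0 mΩ) (X : ℝ≥0 → Ω → M) (P : M → Measure Ω) : Prop where
  prob : ∀ x, IsProbabilityMeasure (P x)
  adapted : ∀ t, Measurable[ℱ t] (X t)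
  measurable_law : ∀ t A, MeasurableSet A → Measurable fun x => P x (X t ⁻¹' A)
  start : ∀ x, ∀ᵐ ω ∂P x, X 0 ω = x
  measurable_stopped : ∀ (τ : Ω → WithTop ℝ≥0) (hτ : IsStoppingTime ℱ τ) (A : Set M),
    MeasurableSet A →
      MeasurableSet[hτ.measurableSpace] {ω | τ ω ≠ ⊤ ∧ X (τ ω).untopA ω ∈ A}
  strongMarkov : ∀ (τ : Ω → WithTop ℝ≥0) (hτ : IsStoppingTime ℱ τ) (x : M) (s : ℝ≥0)
    (A : Set M) (B : Set Ω), MeasurableSet A → MeasurableSet[hτ.measurableSpace] B →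
      P x {ω | ω ∈ B ∧ τ ω ≠ ⊤ ∧ X ((τ ω).untopA + s) ω ∈ A} =
        ∫⁻ ω in {ω | ω ∈ B ∧ τ ω ≠ ⊤}, P (X (τ ω).untopA ω) (X s ⁻¹' A) ∂P x

/-- `q(t,x,y)`, `t > 0`, is a transition density function of the process with respect to `μ`. -/
structure IsTransitionDensity {M Ω : Type*} [MeasurableSpace M] [MeasurableSpace Ω]
    (X : ℝ≥0 → Ω → M) (P : M → Measure Ω) (μ : Measure M) (q : ℝ → M → M → ℝ≥0∞) : Prop where
  measurable : ∀ x, Measurable fun z : ℝ × M => q z.1 x z.2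
  density : ∀ (t : ℝ≥0) (x : M) (A : Set M), 0 < t → MeasurableSet A →
    P x (X t ⁻¹' A) = ∫⁻ y in A, q t x y ∂μ

/-- The stable-like bound `1/V(x,Φ⁻¹(t)) ∧ t/(V(x,d(x,y)) Φ(d(x,y)))` in `[0,∞]`; the second term
is `∞` for `x = y`. -/
noncomputable def jumpBound {M : Type*} [PseudoMetricSpace M] [MeasurableSpace M] (μ : Measure M)
    (Φ : ℝ → ℝ) (t : ℝ) (x y : M) : ℝ≥0∞ :=
  min (1 / vol μ x (incInv Φ t))
    (ENNReal.ofReal t / (vol μ x (dist x y) * ENNReal.ofReal (Φ (dist x y))))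

end TimeFractional

/-! Fix t, put f = φ(1/t), g = 1/f, a = Φ(d(x,y)), and let m be the Stieltjes measure of r ↦ P(S_r ≥
t), the law of the first passage time of S to [t,∞). Then p is the integral of q against m, and the
theorem holds because m behaves like f dr up to the scale g and has an exponential tail beyond it.
No density is needed for this: it suffices that m(0,r] ≤ 2 f r for all r (`measure_Ioc_le`) and
m(r/N,r] ≥ c f r for r ≤ g (`exists_le_measure_Ioc`).

The upper bound and the tail are Markov inequalities for exp(-S_r/t). The lower bound is the
delicate one: it must exclude that S_r is built from small jumps only. This is where β₂ < 1 enters,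
through an estimate of E[min(S_r, t)] (`integral_min_le`, `exists_le_tailFunction`).

The function h(r) = 1/V(x,Φ⁻¹(r)) is non-increasing and doubling, so averaging over windows of
bounded ratio and applying Tonelli exchanges m for f dr in integrals of h, even when these are
infinite (`setLIntegral_antitone_le_volume`, `setLIntegral_volume_le_antitone`).

If a ≤ g, the kernel is at most a multiple of h(a) on (0,a] and comparable to h on (a,∞). All
contributions fit into f times the integral of h over (a,2g]; the upper limit 2g keeps that interval
from degenerating when a = g. If a ≥ g, the kernel is comparable to r/(V(x,d)Φ(d)) for r ≤ a and
bounded by a multiple of it for every r. The mean of m, at most e/f (`lintegral_id_le`), gives the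
upper bound, and the window (g/N,g] the lower one. -/

namespace TimeFractional

/-! ### Exchanging a measure for Lebesgue measure -/

/-- If `m (0,r] ≤ K r` and `h` is non-increasing and doubling, then the integral of `h` with respect
to `m` is bounded by its Lebesgue integral. -/
theorem setLIntegral_antitone_le_volume {m : Measure ℝ} [SFinite m] {h : ℝ → ℝ≥0∞}
    (hh : Antitone h) {D K : ℝ≥0∞} (hD : ∀ u, 0 < u → h u ≤ D * h (2 * u))
    (hm : ∀ r, 0 < r → m (Ioc 0 r) ≤ K * ENNReal.ofReal r) {a b : ℝ} (ha : 0 ≤ a) :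
    ∫⁻ u in Ioc a b, h u ∂m ≤ 2 * D * K * ∫⁻ r in Ioc a (2 * b), h r := by
  have hmeas := hh.measurable
  -- By doubling, `h u` is at most D times the average of `h` over (u,2u]. After Tonelli a fixed r
  -- only meets u in [r/2,r), where 1/u ≤ 2/r and the mass is at most K r.
  let T : Set (ℝ × ℝ) := {z | z.1 < z.2 ∧ z.2 ≤ 2 * z.1}
  have hT : MeasurableSet T := by
    apply MeasurableSet.inter
    · exact measurableSet_lt measurable_fst measurable_snd
    · exact measurableSet_le measurable_snd (measurable_fst.const_mul 2)
  let k : ℝ × ℝ → ℝ≥0∞ := T.indicator fun z => (ENNReal.ofReal z.1)⁻¹ * (D * h z.2)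
  have hk : Measurable k := by
    refine Measurable.indicator ?_ hT
    exact (measurable_fst.ennreal_ofReal.inv).mul ((hmeas.comp measurable_snd).const_mul D)
  have h1 : ∀ u ∈ Ioc a b, h u ≤ ∫⁻ r in Ioc a (2 * b), k (u, r) := by
    intro u hu
    have hu0 : 0 < u := ha.trans_lt hu.1
    have e : ∫⁻ _ in Ioc u (2 * u), (ENNReal.ofReal u)⁻¹ * h u = h u := by
      rw [setLIntegral_const, Real.volume_Ioc, show 2 * u - u = u by ring, mul_right_comm,
        ENNReal.inv_mul_cancel (by simpa using hu0) ENNReal.ofReal_ne_top, one_mul]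
    calc h u = ∫⁻ _ in Ioc u (2 * u), (ENNReal.ofReal u)⁻¹ * h u := e.symm
      _ ≤ ∫⁻ r in Ioc u (2 * u), k (u, r) := by
        refine setLIntegral_mono' measurableSet_Ioc fun r hr => ?_
        have : (u, r) ∈ T := hr
        simp only [k, indicator_of_mem this]
        gcongr
        exact (hD u hu0).trans (by gcongr; exact hh hr.2)
      _ ≤ ∫⁻ r in Ioc a (2 * b), k (u, r) :=
        lintegral_mono_set (Ioc_subset_Ioc hu.1.le (by linarith [hu.2]))
  calc ∫⁻ u in Ioc a b, h u ∂m
      ≤ ∫⁻ u in Ioc a b, (∫⁻ r in Ioc a (2 * b), k (u, r)) ∂m :=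
        setLIntegral_mono' measurableSet_Ioc h1
    _ = ∫⁻ r in Ioc a (2 * b), ∫⁻ u in Ioc a b, k (u, r) ∂m :=
        lintegral_lintegral_swap (f := fun u r => k (u, r)) hk.aemeasurable
    _ ≤ ∫⁻ r in Ioc a (2 * b), 2 * D * K * h r := by
        refine setLIntegral_mono' measurableSet_Ioc fun r hr => ?_
        have hr0 : 0 < r := ha.trans_lt hr.1
        calc ∫⁻ u in Ioc a b, k (u, r) ∂m
            ≤ ∫⁻ u, (Ioc 0 r).indicator
                (fun _ => (ENNReal.ofReal (r / 2))⁻¹ * (D * h r)) u ∂m := by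
              refine (setLIntegral_le_lintegral _ _).trans (lintegral_mono fun u => ?_)
              by_cases hu : (u, r) ∈ T
              · have hu' : u < r ∧ r ≤ 2 * u := hu
                have : u ∈ Ioc 0 r := ⟨by linarith, hu'.1.le⟩
                simp only [k, indicator_of_mem hu, indicator_of_mem this]
                gcongr
                linarith
              · simp [k, indicator_of_notMem hu]
          _ = (ENNReal.ofReal (r / 2))⁻¹ * (D * h r) * m (Ioc 0 r) := by
              rw [lintegral_indicator_const measurableSet_Ioc]
          _ ≤ (ENNReal.ofReal (r / 2))⁻¹ * (D * h r) * (K * ENNReal.ofReal r) := by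
              gcongr
              exact hm r hr0
          _ = 2 * D * K * h r := by
              have e : ENNReal.ofReal r = 2 * ENNReal.ofReal (r / 2) := by
                rw [← ENNReal.ofReal_ofNat, ← ENNReal.ofReal_mul (by norm_num)]
                congr 1; ring
              have e2 : (ENNReal.ofReal (r / 2))⁻¹ * ENNReal.ofReal (r / 2) = 1 :=
                ENNReal.inv_mul_cancel (by simpa using hr0) ENNReal.ofReal_ne_top
              rw [e]
              calc _ = 2 * D * K * h r * ((ENNReal.ofReal (r / 2))⁻¹ * ENNReal.ofReal (r / 2)) := by
                    ring
                _ = _ := by rw [e2, mul_one]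
    _ = 2 * D * K * ∫⁻ r in Ioc a (2 * b), h r := lintegral_const_mul _ hmeas

/-- If `c r ≤ m (r/N,r]` for `r ≤ b` and `h` is non-increasing, then the Lebesgue integral of `h` is
bounded by its integral with respect to `m`. -/
theorem setLIntegral_volume_le_antitone {m : Measure ℝ} [SFinite m] {h : ℝ → ℝ≥0∞}
    (hh : Antitone h) {c : ℝ≥0∞} {N a b : ℝ} (hN : 1 ≤ N)
    (hm : ∀ r, 0 < r → r ≤ b → c * ENNReal.ofReal r ≤ m (Ioc (r / N) r)) (ha : 0 ≤ a) :
    c * ∫⁻ r in Ioc a b, h r ≤ ENNReal.ofReal N * ∫⁻ u in Ioc (a / N) b, h u ∂m := by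
  have hmeas := hh.measurable
  have hN0 : 0 < N := by linarith
  -- The point r is charged to the window (r/N,r]. After Tonelli a fixed u only receives r in
  -- [u,Nu), where h(r)/r ≤ h(u)/u, and this range has length at most N u.
  let T : Set (ℝ × ℝ) := {z | z.1 / N < z.2 ∧ z.2 ≤ z.1}
  have hT : MeasurableSet T := by
    apply MeasurableSet.inter
    · exact measurableSet_lt (measurable_fst.div_const N) measurable_snd
    · exact measurableSet_le measurable_snd measurable_fst
  let k : ℝ × ℝ → ℝ≥0∞ := T.indicator fun z => (ENNReal.ofReal z.1)⁻¹ * h z.1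
  have hk : Measurable k := by
    refine Measurable.indicator ?_ hT
    exact (measurable_fst.ennreal_ofReal.inv).mul (hmeas.comp measurable_fst)
  have h1 : ∀ r ∈ Ioc a b, c * h r ≤ ∫⁻ u in Ioc (a / N) b, k (r, u) ∂m := by
    intro r hr
    have hr0 : 0 < r := ha.trans_lt hr.1
    have e2 : (ENNReal.ofReal r)⁻¹ * ENNReal.ofReal r = 1 :=
      ENNReal.inv_mul_cancel (by simpa using hr0) ENNReal.ofReal_ne_top
    calc c * h r = (ENNReal.ofReal r)⁻¹ * h r * (c * ENNReal.ofReal r) := by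
          calc _ = c * h r * ((ENNReal.ofReal r)⁻¹ * ENNReal.ofReal r) := by rw [e2, mul_one]
            _ = _ := by ring
      _ ≤ (ENNReal.ofReal r)⁻¹ * h r * m (Ioc (r / N) r) := by
          gcongr
          exact hm r hr0 hr.2
      _ = ∫⁻ _ in Ioc (r / N) r, (ENNReal.ofReal r)⁻¹ * h r ∂m := by rw [setLIntegral_const]
      _ ≤ ∫⁻ u in Ioc (r / N) r, k (r, u) ∂m := by
          refine setLIntegral_mono' measurableSet_Ioc fun u hu => ?_
          have : (r, u) ∈ T := hu
          simp only [k, indicator_of_mem this, le_refl]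
      _ ≤ ∫⁻ u in Ioc (a / N) b, k (r, u) ∂m :=
          lintegral_mono_set (Ioc_subset_Ioc (by gcongr; exact hr.1.le) hr.2)
  calc c * ∫⁻ r in Ioc a b, h r = ∫⁻ r in Ioc a b, c * h r := (lintegral_const_mul _ hmeas).symm
    _ ≤ ∫⁻ r in Ioc a b, ∫⁻ u in Ioc (a / N) b, k (r, u) ∂m :=
        setLIntegral_mono' measurableSet_Ioc h1
    _ = ∫⁻ u in Ioc (a / N) b, (∫⁻ r in Ioc a b, k (r, u)) ∂m :=
        lintegral_lintegral_swap (f := fun r u => k (r, u)) hk.aemeasurable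
    _ ≤ ∫⁻ u in Ioc (a / N) b, ENNReal.ofReal N * h u ∂m := by
        refine setLIntegral_mono' measurableSet_Ioc fun u hu => ?_
        have hu0 : 0 < u := lt_of_le_of_lt (by positivity) hu.1
        calc ∫⁻ r in Ioc a b, k (r, u)
            ≤ ∫⁻ r, (Icc 0 (N * u)).indicator
                (fun _ => (ENNReal.ofReal u)⁻¹ * h u) r := by
              refine (setLIntegral_le_lintegral _ _).trans (lintegral_mono fun r => ?_)
              by_cases hr : (r, u) ∈ T
              · have hr' : r / N < u ∧ u ≤ r := hr
                have : r ∈ Icc 0 (N * u) :=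
                  ⟨by linarith [hr'.2], by have := (div_lt_iff₀ hN0).1 hr'.1; linarith⟩
                simp only [k, indicator_of_mem hr, indicator_of_mem this]
                gcongr
                · exact hr'.2
                · exact hh hr'.2
              · simp [k, indicator_of_notMem hr]
          _ = (ENNReal.ofReal u)⁻¹ * h u * (ENNReal.ofReal N * ENNReal.ofReal u) := by
              rw [lintegral_indicator_const measurableSet_Icc, Real.volume_Icc, sub_zero,
                ENNReal.ofReal_mul hN0.le]
          _ = ENNReal.ofReal N * h u := by
              have e2 : (ENNReal.ofReal u)⁻¹ * ENNReal.ofReal u = 1 :=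
                ENNReal.inv_mul_cancel (by simpa using hu0) ENNReal.ofReal_ne_top
              calc _ = ENNReal.ofReal N * h u * ((ENNReal.ofReal u)⁻¹ * ENNReal.ofReal u) := by ring
                _ = _ := by rw [e2, mul_one]
    _ = ENNReal.ofReal N * ∫⁻ u in Ioc (a / N) b, h u ∂m := lintegral_const_mul _ hmeas

/-- Rescaling of the Lebesgue integral over an interval. -/
theorem ofReal_mul_setLIntegral_Ioc (f : ℝ → ℝ≥0∞) {l : ℝ} (hl : 0 < l) (a b : ℝ) :
    ENNReal.ofReal l * ∫⁻ r in Ioc a (b / l), f r = ∫⁻ r in Ioc (a * l) b, f (r / l) := by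
  let e : ℝ ≃ᵐ ℝ := (Homeomorph.mulRight₀ l hl.ne').toMeasurableEquiv
  have he : ∀ r, e r = r * l := fun r => rfl
  have hmap : Measure.map e volume = ENNReal.ofReal l⁻¹ • volume := by
    have := Real.map_volume_mul_right hl.ne'
    rwa [abs_of_pos (inv_pos.2 hl)] at this
  have hvol : (volume : Measure ℝ) = ENNReal.ofReal l • Measure.map e volume := by
    rw [hmap, smul_smul, ← ENNReal.ofReal_mul hl.le, mul_inv_cancel₀ hl.ne', ENNReal.ofReal_one,
      one_smul]
  have hpre : e ⁻¹' Ioc (a * l) b = Ioc a (b / l) := by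
    ext r
    simp only [mem_preimage, he, mem_Ioc, mul_lt_mul_iff_left₀ hl, le_div_iff₀ hl]
  conv_rhs => rw [hvol, Measure.restrict_smul, lintegral_smul_measure, e.restrict_map,
    lintegral_map_equiv, hpre]
  simp [he, hl.ne']

/-! ### Tail estimates for the subordinator -/

namespace IsSubordinator

variable {Ω : Type*} [MeasurableSpace Ω] {S : ℝ≥0 → Ω → ℝ} {P : Measure Ω}

theorem ae_nonneg (hS : IsSubordinator S P) (t : ℝ≥0) : ∀ᵐ ω ∂P, 0 ≤ S t ω := by
  filter_upwards [hS.zero, hS.mono] with ω h0 hm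
  exact h0 ▸ hm zero_le

variable [IsProbabilityMeasure P]

theorem integrable_exp_neg_mul (hS : IsSubordinator S P) (t : ℝ≥0) {l : ℝ} (hl : 0 ≤ l) :
    Integrable (fun ω => Real.exp (-(l * S t ω))) P := by
  refine Integrable.of_bound ((hS.measurable t).const_mul l).neg.exp.aestronglyMeasurable 1 ?_
  filter_upwards [hS.ae_nonneg t] with ω hω
  rw [Real.norm_eq_abs, abs_of_pos (Real.exp_pos _), Real.exp_le_one_iff]
  have := mul_nonneg hl hω
  linarith

theorem tailFunction_apply (hS : IsSubordinator S P) (t r : ℝ) :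
    hS.tailFunction t r = P.real {ω | t ≤ S r.toNNReal ω} := rfl

theorem tailFunction_nonneg (hS : IsSubordinator S P) (t r : ℝ) : 0 ≤ hS.tailFunction t r :=
  measureReal_nonneg

theorem tailFunction_le_one (hS : IsSubordinator S P) (t r : ℝ) : hS.tailFunction t r ≤ 1 :=
  measureReal_le_one

theorem tailFunction_zero (hS : IsSubordinator S P) {t : ℝ} (ht : 0 < t) :
    hS.tailFunction t 0 = 0 := by
  rw [tailFunction_apply, measureReal_def, ENNReal.toReal_eq_zero_iff]
  left
  rw [measure_eq_zero_iff_ae_notMem]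
  filter_upwards [hS.zero] with ω hω
  simpa [hω] using ht

theorem integral_one_sub_exp (hS : IsSubordinator S P) {φ : ℝ → ℝ} (hφ : IsLaplaceExponent S P φ)
    (r : ℝ≥0) {l : ℝ} (hl : 0 < l) :
    ∫ ω, (1 - Real.exp (-(l * S r ω))) ∂P = 1 - Real.exp (-(r * φ l)) := by
  rw [integral_sub (integrable_const _) (hS.integrable_exp_neg_mul r hl.le), hφ r l hl]
  simp

/-- Markov's inequality for 1 - exp(-S_r/t), which exceeds 1/2 on {S_r ≥ t}, followed by 1 - e^(-x)
≤ x. -/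
theorem tailFunction_le (hS : IsSubordinator S P) {φ : ℝ → ℝ} (hφ : IsLaplaceExponent S P φ)
    {t r : ℝ} (ht : 0 < t) (hr : 0 ≤ r) : hS.tailFunction t r ≤ 2 * (r * φ t⁻¹) := by
  have hA : MeasurableSet {ω | t ≤ S r.toNNReal ω} :=
    measurableSet_le measurable_const (hS.measurable _)
  have h1 : ∫ ω, {ω | t ≤ S r.toNNReal ω}.indicator (fun _ => (2⁻¹ : ℝ)) ω ∂P ≤
      ∫ ω, (1 - Real.exp (-(t⁻¹ * S r.toNNReal ω))) ∂P := by
    refine integral_mono_ae ((integrable_const _).indicator hA)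
      ((integrable_const _).sub (hS.integrable_exp_neg_mul _ (by positivity))) ?_
    filter_upwards [hS.ae_nonneg r.toNNReal] with ω hω
    have h0 : 0 ≤ t⁻¹ * S r.toNNReal ω := by positivity
    by_cases h : t ≤ S r.toNNReal ω
    · rw [indicator_of_mem (show ω ∈ {ω | t ≤ S r.toNNReal ω} from h)]
      have h2 : 1 ≤ t⁻¹ * S r.toNNReal ω := by
        rw [inv_mul_eq_div, one_le_div ht]; exact h
      have h3 : Real.exp (-(t⁻¹ * S r.toNNReal ω)) ≤ Real.exp (-1) := Real.exp_le_exp.2 (by linarith)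
      have h4 := Real.exp_neg_one_lt_half
      linarith
    · rw [indicator_of_notMem (show ω ∉ {ω | t ≤ S r.toNNReal ω} from h)]
      have : Real.exp (-(t⁻¹ * S r.toNNReal ω)) ≤ 1 := Real.exp_le_one_iff.2 (by linarith)
      linarith
  rw [integral_indicator_const _ hA, hS.integral_one_sub_exp hφ _ (inv_pos.2 ht),
    Real.coe_toNNReal r hr, smul_eq_mul, ← hS.tailFunction_apply] at h1
  have h2 := Real.add_one_le_exp (-(r * φ t⁻¹))
  linarith

/-- Exponential Markov inequality: e · exp(-S_r/t) ≥ 1 on {S_r < t}. The decay in r is what bounds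
the mean of the passage time. -/
theorem one_sub_tailFunction_le (hS : IsSubordinator S P) {φ : ℝ → ℝ}
    (hφ : IsLaplaceExponent S P φ) {t r : ℝ} (ht : 0 < t) (hr : 0 ≤ r) :
    1 - hS.tailFunction t r ≤ Real.exp 1 * Real.exp (-(r * φ t⁻¹)) := by
  have hA : MeasurableSet {ω | t ≤ S r.toNNReal ω} :=
    measurableSet_le measurable_const (hS.measurable _)
  have h1 : ∫ ω, {ω | t ≤ S r.toNNReal ω}ᶜ.indicator (fun _ => (1 : ℝ)) ω ∂P ≤
      ∫ ω, Real.exp 1 * Real.exp (-(t⁻¹ * S r.toNNReal ω)) ∂P := by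
    refine integral_mono_ae ((integrable_const _).indicator hA.compl)
      ((hS.integrable_exp_neg_mul _ (by positivity)).const_mul _) (ae_of_all _ fun ω => ?_)
    by_cases h : t ≤ S r.toNNReal ω
    · rw [indicator_of_notMem (by simpa using h)]
      positivity
    · rw [indicator_of_mem (by simpa using h)]
      simp only
      rw [← Real.exp_add]
      refine Real.one_le_exp ?_
      have : t⁻¹ * S r.toNNReal ω < 1 := by
        rw [inv_mul_eq_div, div_lt_one ht]; exact not_le.1 h
      linarith
  rw [integral_indicator_const _ hA.compl, integral_const_mul, hφ _ _ (inv_pos.2 ht),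
    Real.coe_toNNReal r hr, smul_eq_mul, mul_one, probReal_compl_eq_one_sub hA] at h1
  exact h1

/-- The truncated mean of `S_r`, estimated from the upper scaling of the Laplace exponent. -/
theorem integral_min_le (hS : IsSubordinator S P) {φ : ℝ → ℝ}
    (hφ : IsLaplaceExponent S P φ) {β C : ℝ} (hβ : β < 1) (hC : 0 ≤ C)
    (hsc : ∀ r R, 0 < r → r ≤ R → φ R ≤ C * (R / r) ^ β * φ r)
    {t r : ℝ} (ht : 0 < t) (hr : 0 ≤ r) (hφt : 0 ≤ φ t⁻¹) :
    ∫ ω, min (S r.toNNReal ω) t ∂P ≤ 2 * C / (1 - β) * t * (r * φ t⁻¹) := by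
  set A : ℝ := 2 * C * (r * φ t⁻¹) * t ^ β with hA
  have hA0 : 0 ≤ A := by positivity
  have hβ' : 0 < 1 - β := by linarith
  have hmeas : Measurable fun ω => min (S r.toNNReal ω) t := (hS.measurable _).min measurable_const
  have hnn : 0 ≤ᵐ[P] fun ω => min (S r.toNNReal ω) t := by
    filter_upwards [hS.ae_nonneg r.toNNReal] with ω hω
    exact le_min hω ht.le
  have hrhs : 2 * C / (1 - β) * t * (r * φ t⁻¹) = ∫ u in (0 : ℝ)..t, A * u ^ (-β) := by
    rw [intervalIntegral.integral_const_mul, integral_rpow (Or.inl (by linarith)),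
      Real.zero_rpow (by linarith), hA, sub_zero, show -β + 1 = 1 - β by ring]
    have : t ^ β * t ^ (1 - β) = t := by
      rw [← Real.rpow_add ht]; simp
    calc 2 * C / (1 - β) * t * (r * φ t⁻¹) =
          2 * C / (1 - β) * (t ^ β * t ^ (1 - β)) * (r * φ t⁻¹) := by rw [this]
      _ = _ := by ring
  have hint : IntegrableOn (fun u : ℝ => A * u ^ (-β)) (Ioc 0 t) := by
    have : IntervalIntegrable (fun u : ℝ => A * u ^ (-β)) volume 0 t :=
      (intervalIntegral.intervalIntegrable_rpow' (by linarith)).const_mul A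
    exact (intervalIntegrable_iff_integrableOn_Ioc_of_le ht.le).1 this
  rw [hrhs, intervalIntegral.integral_of_le ht.le,
    integral_eq_lintegral_of_nonneg_ae hnn hmeas.aestronglyMeasurable]
  have hnn2 : 0 ≤ᵐ[volume.restrict (Ioc 0 t)] fun u : ℝ => A * u ^ (-β) := by
    filter_upwards [ae_restrict_mem measurableSet_Ioc] with u hu
    exact mul_nonneg hA0 (Real.rpow_nonneg hu.1.le _)
  rw [integral_eq_lintegral_of_nonneg_ae hnn2 hint.aestronglyMeasurable]
  refine ENNReal.toReal_mono ?_ ?_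
  · rw [← ofReal_integral_eq_lintegral_ofReal hint hnn2]
    exact ENNReal.ofReal_ne_top
  -- Layer cake: only levels u ≤ t contribute, and there φ(1/u) ≤ C (t/u)^β φ(1/t) bounds the tail
  -- by a multiple of u^(-β), integrable at 0 because β < 1.
  rw [lintegral_eq_lintegral_meas_le P hnn hmeas.aemeasurable]
  calc ∫⁻ u in Ioi 0, P {ω | u ≤ min (S r.toNNReal ω) t}
      ≤ ∫⁻ u in Ioi 0, (Iic t).indicator (fun u => ENNReal.ofReal (A * u ^ (-β))) u := by
        refine setLIntegral_mono' measurableSet_Ioi fun u hu => ?_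
        have hu0 : 0 < u := hu
        by_cases hut : u ≤ t
        · rw [indicator_of_mem (show u ∈ Iic t from hut)]
          refine (measure_mono (t := {ω | u ≤ S r.toNNReal ω})
            fun ω hω => show u ≤ S r.toNNReal ω from
              le_trans (show u ≤ min (S r.toNNReal ω) t from hω) (min_le_left _ _)).trans ?_
          rw [← ENNReal.ofReal_toReal (measure_ne_top P _)]
          refine ENNReal.ofReal_le_ofReal ((hS.tailFunction_le hφ hu0 hr).trans ?_)
          have h1 := hsc t⁻¹ u⁻¹ (inv_pos.2 ht) (inv_anti₀ hu0 hut)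
          have h2 : u⁻¹ / t⁻¹ = t * u⁻¹ := by rw [div_inv_eq_mul, mul_comm]
          rw [h2, Real.mul_rpow ht.le (by positivity), Real.inv_rpow hu0.le,
            ← Real.rpow_neg hu0.le] at h1
          calc 2 * (r * φ u⁻¹) ≤ 2 * (r * (C * (t ^ β * u ^ (-β)) * φ t⁻¹)) := by gcongr
            _ = A * u ^ (-β) := by rw [hA]; ring
        · rw [indicator_of_notMem (show u ∉ Iic t from hut)]
          have : {ω | u ≤ min (S r.toNNReal ω) t} = ∅ :=
            eq_empty_of_forall_notMem fun ω hω => hut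
              (le_trans (show u ≤ min (S r.toNNReal ω) t from hω) (min_le_right _ _))
          rw [this, measure_empty]
    _ = ∫⁻ u in Ioc 0 t, ENNReal.ofReal (A * u ^ (-β)) := by
        rw [lintegral_indicator measurableSet_Iic, Measure.restrict_restrict measurableSet_Iic,
          inter_comm, Ioi_inter_Iic]

/-- If the upper scaling index of the Laplace exponent is smaller than one, then
`P(S_r ≥ t) ≥ c r φ(1/t)` for `r ≤ 1/φ(1/t)`. -/
theorem exists_le_tailFunction (hS : IsSubordinator S P) {φ : ℝ → ℝ}
    (hφ : IsLaplaceExponent S P φ) {β₁ β₂ : ℝ} (hβ₂ : β₂ < 1) (hφs : WeakScaling φ β₁ β₂) :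
    ∃ c : ℝ, 0 < c ∧ ∀ t r, 0 < t → 0 ≤ r → r * φ t⁻¹ ≤ 1 →
      c * (r * φ t⁻¹) ≤ hS.tailFunction t r := by
  obtain ⟨hβ₁, hβ, _, C, -, hC, hw⟩ := hφs
  have hsc : ∀ r R, 0 < r → r ≤ R → φ R ≤ C * (R / r) ^ β₂ * φ r := fun r R hr hrR =>
    (div_le_iff₀ (hw.pos r hr)).1 (hw.upper r R hr hrR)
  set B := 2 * C / (1 - β₂) with hB
  have hβ' : 0 < 1 - β₂ := by linarith
  have hB0 : 0 < B := by positivity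
  -- Below, the truncated mean costs B ε while the Laplace exponent at ε/t still yields a multiple
  -- of ε^β₂; since β₂ < 1, a small ε makes the cost at most half of the yield.
  obtain ⟨ε, hε0, hε1, hε⟩ : ∃ ε : ℝ, 0 < ε ∧ ε ≤ 1 ∧ B * ε ≤ (4 * C)⁻¹ * ε ^ β₂ := by
    have hlim : Tendsto (fun ε : ℝ => B * ε ^ (1 - β₂)) (𝓝[>] 0) (𝓝 0) := by
      have := ((Real.continuousAt_rpow_const 0 (1 - β₂) (Or.inr hβ'.le)).tendsto.const_mul B)
      rw [Real.zero_rpow hβ'.ne', mul_zero] at this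
      exact this.mono_left nhdsWithin_le_nhds
    have h1 := hlim.eventually_lt_const (show (0 : ℝ) < (4 * C)⁻¹ by positivity)
    have h2 : ∀ᶠ ε : ℝ in 𝓝[>] 0, ε ∈ Ioc (0 : ℝ) 1 := Ioc_mem_nhdsGT one_pos
    obtain ⟨ε, h3, h4⟩ := (h1.and h2).exists
    refine ⟨ε, h4.1, h4.2, ?_⟩
    have e : ε = ε ^ (1 - β₂) * ε ^ β₂ := by
      rw [← Real.rpow_add h4.1]; simp
    calc B * ε = B * ε ^ (1 - β₂) * ε ^ β₂ := by rw [mul_assoc, ← e]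
      _ ≤ _ := by
        have := Real.rpow_nonneg h4.1.le β₂
        gcongr
  refine ⟨(4 * C)⁻¹ * ε ^ β₂, by positivity, fun t r ht hr hrt => ?_⟩
  have hφt : 0 < φ t⁻¹ := hw.pos _ (inv_pos.2 ht)
  set l := ε * t⁻¹ with hl
  have hl0 : 0 < l := by positivity
  have hlt : l ≤ t⁻¹ := mul_le_of_le_one_left (by positivity) hε1
  have hφl : C⁻¹ * ε ^ β₂ * φ t⁻¹ ≤ φ l := by
    have h1 := hsc l t⁻¹ hl0 hlt
    have h2 : t⁻¹ / l = ε⁻¹ := by rw [hl]; field_simp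
    rw [h2, Real.inv_rpow hε0.le] at h1
    have : (0 : ℝ) < ε ^ β₂ := Real.rpow_pos_of_pos hε0 _
    calc C⁻¹ * ε ^ β₂ * φ t⁻¹ ≤ C⁻¹ * ε ^ β₂ * (C * (ε ^ β₂)⁻¹ * φ l) := by gcongr
      _ = φ l := by field_simp
  have hA : MeasurableSet {ω | t ≤ S r.toNNReal ω} :=
    measurableSet_le measurable_const (hS.measurable _)
  have hmin : Integrable (fun ω => min (S r.toNNReal ω) t) P := by
    refine Integrable.of_bound ((hS.measurable _).min measurable_const).aestronglyMeasurable t ?_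
    filter_upwards [hS.ae_nonneg r.toNNReal] with ω hω
    rw [Real.norm_eq_abs, abs_of_nonneg (le_min hω ht.le)]
    exact min_le_right _ _
  -- Pointwise, 1 - e^(-ls) is at most the indicator of s ≥ t plus l · min(s,t). Bounding the last
  -- mean from above leaves a lower bound for the probability.
  have h1 : ∫ ω, (1 - Real.exp (-(l * S r.toNNReal ω))) ∂P ≤
      ∫ ω, ({ω | t ≤ S r.toNNReal ω}.indicator (fun _ => (1 : ℝ)) ω +
        l * min (S r.toNNReal ω) t) ∂P := by
    refine integral_mono_ae ((integrable_const _).sub (hS.integrable_exp_neg_mul _ hl0.le))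
      (((integrable_const _).indicator hA).add (hmin.const_mul l)) (ae_of_all _ fun ω => ?_)
    beta_reduce
    by_cases h : t ≤ S r.toNNReal ω
    · rw [indicator_of_mem (show ω ∈ {ω | t ≤ S r.toNNReal ω} from h)]
      have := Real.exp_pos (-(l * S r.toNNReal ω))
      have h3 : 0 ≤ l * min (S r.toNNReal ω) t := mul_nonneg hl0.le (le_min (ht.le.trans h) ht.le)
      linarith
    · rw [indicator_of_notMem (show ω ∉ {ω | t ≤ S r.toNNReal ω} from h),
        min_eq_left (not_le.1 h).le]
      have := Real.add_one_le_exp (-(l * S r.toNNReal ω))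
      linarith
  rw [hS.integral_one_sub_exp hφ _ hl0, integral_add ((integrable_const _).indicator hA)
    (hmin.const_mul l), integral_indicator_const _ hA, integral_const_mul,
    Real.coe_toNNReal r hr, smul_eq_mul, mul_one, ← hS.tailFunction_apply] at h1
  have h2 := hS.integral_min_le hφ hβ₂ hC.le hsc ht hr hφt.le
  have h3 : l * ∫ ω, min (S r.toNNReal ω) t ∂P ≤ B * ε * (r * φ t⁻¹) := by
    calc _ ≤ l * (B * t * (r * φ t⁻¹)) := by gcongr
      _ = _ := by rw [hl]; field_simp
  have hx1 : r * φ l ≤ 1 := by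
    refine le_trans ?_ hrt
    gcongr
    exact hw.mono hl0 (inv_pos.2 ht) hlt
  have hx0 : 0 ≤ r * φ l := mul_nonneg hr (hw.pos l hl0).le
  -- For 0 ≤ x ≤ 1, 1 - e^(-x) ≥ x/(1+x) ≥ x/2; this is where r φ(1/t) ≤ 1 is needed.
  have h4 : r * φ l / 2 ≤ 1 - Real.exp (-(r * φ l)) := by
    have h5 : Real.exp (-(r * φ l)) ≤ (1 + r * φ l)⁻¹ := by
      rw [Real.exp_neg]
      exact inv_anti₀ (by linarith) (by linarith [Real.add_one_le_exp (r * φ l)])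
    have h6 : (1 + r * φ l)⁻¹ ≤ 1 - r * φ l / 2 := by
      rw [inv_le_iff_one_le_mul₀ (by linarith)]
      nlinarith
    linarith
  have h7 : C⁻¹ * ε ^ β₂ * (r * φ t⁻¹) ≤ r * φ l := by
    calc _ = r * (C⁻¹ * ε ^ β₂ * φ t⁻¹) := by ring
      _ ≤ _ := by gcongr
  have h8 : B * ε * (r * φ t⁻¹) ≤ (4 * C)⁻¹ * ε ^ β₂ * (r * φ t⁻¹) := by gcongr
  have h9 : (4 * C)⁻¹ * ε ^ β₂ * (r * φ t⁻¹) = C⁻¹ * ε ^ β₂ * (r * φ t⁻¹) / 4 := by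
    rw [mul_inv]; ring
  linarith

theorem measure_Ioc_le (hS : IsSubordinator S P) {φ : ℝ → ℝ} (hφ : IsLaplaceExponent S P φ)
    {t r : ℝ} (ht : 0 < t) (hr : 0 ≤ r) (hφt : 0 ≤ φ t⁻¹) :
    (hS.tailFunction t).measure (Ioc 0 r) ≤
      2 * ENNReal.ofReal (φ t⁻¹) * ENNReal.ofReal r := by
  rw [StieltjesFunction.measure_Ioc, hS.tailFunction_zero ht, sub_zero, ← ENNReal.ofReal_ofNat,
    ← ENNReal.ofReal_mul (by norm_num), ← ENNReal.ofReal_mul (by positivity)]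
  refine ENNReal.ofReal_le_ofReal ((hS.tailFunction_le hφ ht hr).trans (le_of_eq (by ring)))

theorem measure_Ioi_le (hS : IsSubordinator S P) (t r : ℝ) :
    (hS.tailFunction t).measure (Ioi r) ≤ ENNReal.ofReal (1 - hS.tailFunction t r) := by
  have hu : Ioi r = ⋃ n : ℕ, Ioc r (r + n) := by
    ext x
    simp only [mem_Ioi, mem_iUnion, mem_Ioc, exists_and_left]
    refine ⟨fun h => ⟨h, ?_⟩, fun h => h.1⟩
    obtain ⟨n, hn⟩ := exists_nat_ge (x - r)
    exact ⟨n, by linarith⟩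
  rw [hu, Monotone.measure_iUnion]
  · refine iSup_le fun n => ?_
    rw [StieltjesFunction.measure_Ioc]
    exact ENNReal.ofReal_le_ofReal (by linarith [hS.tailFunction_le_one t (r + n)])
  · intro m n hmn
    exact Ioc_subset_Ioc_right (by gcongr)

theorem measure_Ioi_le_one (hS : IsSubordinator S P) (t r : ℝ) :
    (hS.tailFunction t).measure (Ioi r) ≤ 1 := by
  refine (hS.measure_Ioi_le t r).trans ?_
  rw [ENNReal.ofReal_le_one]
  linarith [hS.tailFunction_nonneg t r]

/-- With N ≥ 4/c the upper bound for the tail function at r/N is at most half of its lower bound at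
r, so the increment keeps the other half. This replaces a lower bound on a density. -/
theorem exists_le_measure_Ioc (hS : IsSubordinator S P) {φ : ℝ → ℝ}
    (hφ : IsLaplaceExponent S P φ) {β₁ β₂ : ℝ} (hβ₂ : β₂ < 1) (hφs : WeakScaling φ β₁ β₂) :
    ∃ c N : ℝ, 0 < c ∧ 1 ≤ N ∧ ∀ t r, 0 < t → 0 < r → r * φ t⁻¹ ≤ 1 →
      ENNReal.ofReal c * ENNReal.ofReal (φ t⁻¹) * ENNReal.ofReal r ≤
        (hS.tailFunction t).measure (Ioc (r / N) r) := by
  obtain ⟨c, hc, h⟩ := hS.exists_le_tailFunction hφ hβ₂ hφs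
  obtain ⟨-, -, _, _, -, -, hw⟩ := hφs
  refine ⟨c / 2, max 1 (4 / c), by positivity, le_max_left _ _, fun t r ht hr hrt => ?_⟩
  set N := max 1 (4 / c) with hN
  have hN1 : 1 ≤ N := le_max_left _ _
  have hφt : 0 < φ t⁻¹ := hw.pos _ (inv_pos.2 ht)
  rw [StieltjesFunction.measure_Ioc, ← ENNReal.ofReal_mul (by positivity),
    ← ENNReal.ofReal_mul (by positivity)]
  refine ENNReal.ofReal_le_ofReal ?_
  have h1 := h t r ht hr.le hrt
  have h2 := hS.tailFunction_le hφ ht (show 0 ≤ r / N by positivity)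
  have h3 : 2 * (r / N * φ t⁻¹) ≤ c / 2 * (r * φ t⁻¹) := by
    have : 4 / c ≤ N := le_max_right _ _
    have h4 : 2 / N ≤ c / 2 := by
      rw [div_le_div_iff₀ (by linarith) two_pos]
      rw [div_le_iff₀ hc] at this
      linarith
    calc 2 * (r / N * φ t⁻¹) = 2 / N * (r * φ t⁻¹) := by ring
      _ ≤ _ := by gcongr
  linarith

/-- The mean of the inverse subordinator is at most `e / φ(1/t)`. -/
theorem lintegral_id_le (hS : IsSubordinator S P) {φ : ℝ → ℝ} (hφ : IsLaplaceExponent S P φ)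
    {t : ℝ} (ht : 0 < t) (hφt : 0 < φ t⁻¹) :
    ∫⁻ r in Ioi 0, ENNReal.ofReal r ∂(hS.tailFunction t).measure ≤
      ENNReal.ofReal (Real.exp 1) / ENNReal.ofReal (φ t⁻¹) := by
  set m := (hS.tailFunction t).measure
  have hnn : 0 ≤ᵐ[m.restrict (Ioi 0)] fun r : ℝ => r := by
    filter_upwards [ae_restrict_mem measurableSet_Ioi] with r hr using le_of_lt hr
  -- Layer cake: the mean is the integral over u of the tails m(u,∞), each at most e · exp(-u
  -- φ(1/t)).
  rw [lintegral_eq_lintegral_meas_lt _ hnn aemeasurable_id]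
  have hint := integrableOn_exp_mul_Ioi (a := -φ t⁻¹) (by linarith) 0
  calc ∫⁻ u in Ioi 0, m.restrict (Ioi 0) {r | u < r}
      ≤ ∫⁻ u in Ioi 0, ENNReal.ofReal (Real.exp 1) *
          ENNReal.ofReal (Real.exp (-φ t⁻¹ * u)) := by
        refine setLIntegral_mono' measurableSet_Ioi fun u hu => ?_
        have hu0 : 0 < u := hu
        refine (Measure.restrict_apply_le _ _).trans ((hS.measure_Ioi_le t u).trans ?_)
        rw [← ENNReal.ofReal_mul (by positivity)]
        refine ENNReal.ofReal_le_ofReal ((hS.one_sub_tailFunction_le hφ ht hu0.le).trans ?_)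
        rw [neg_mul, mul_comm u]
    _ = ENNReal.ofReal (Real.exp 1) * ENNReal.ofReal (φ t⁻¹)⁻¹ := by
        rw [lintegral_const_mul' _ _ ENNReal.ofReal_ne_top,
          ← ofReal_integral_eq_lintegral_ofReal hint (ae_of_all _ fun _ => (Real.exp_pos _).le),
          integral_exp_mul_Ioi (by linarith)]
        simp
    _ = _ := by rw [ENNReal.ofReal_inv_of_pos hφt, div_eq_mul_inv]

end IsSubordinator

/-! ### Weak scaling and the generalized inverse -/

section Inverse

variable {Φ : ℝ → ℝ} {α₁ α₂ : ℝ}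

theorem exists_mul_rpow_ge {a c : ℝ} (ha : 0 < a) (hc : 0 < c) (l : ℝ) :
    ∃ K : ℝ, 1 ≤ K ∧ l ≤ c * K ^ a := by
  have h : Tendsto (fun K : ℝ => c * K ^ a) atTop atTop :=
    (tendsto_rpow_atTop ha).const_mul_atTop hc
  exact ((eventually_ge_atTop 1).and (h.eventually_ge_atTop l)).exists

theorem WeakScaling.exists_scale (hΦ : WeakScaling Φ α₁ α₂) (l : ℝ) :
    ∃ K : ℝ, 1 ≤ K ∧ ∀ s, 0 < s → l * Φ s ≤ Φ (K * s) := by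
  obtain ⟨h1, h2, c₁, c₂, hc₁, hc₂, hw⟩ := hΦ
  obtain ⟨K, hK, hl⟩ := exists_mul_rpow_ge h1 hc₁ l
  refine ⟨K, hK, fun s hs => ?_⟩
  have h3 := hw.lower s (K * s) hs (le_mul_of_one_le_left hs.le hK)
  rw [mul_div_cancel_right₀ _ hs.ne'] at h3
  rw [← le_div_iff₀ (hw.pos s hs)]
  exact hl.trans h3

theorem WeakScaling.monotoneOn (hΦ : WeakScaling Φ α₁ α₂) : MonotoneOn Φ (Ioi 0) := by
  obtain ⟨-, -, _, _, -, -, hw⟩ := hΦ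
  exact hw.mono

theorem WeakScaling.pos (hΦ : WeakScaling Φ α₁ α₂) {r : ℝ} (hr : 0 < r) : 0 < Φ r := by
  obtain ⟨-, -, _, _, -, -, hw⟩ := hΦ
  exact hw.pos r hr

theorem WeakScaling.exists_ge (hΦ : WeakScaling Φ α₁ α₂) (r : ℝ) :
    {s | 0 < s ∧ r ≤ Φ s}.Nonempty := by
  have h1 := hΦ.pos one_pos
  obtain ⟨K, hK, h⟩ := hΦ.exists_scale (r / Φ 1)
  refine ⟨K, by linarith, ?_⟩
  have := h 1 one_pos
  rwa [div_mul_cancel₀ _ h1.ne', mul_one] at this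

theorem bddBelow_incInv (Φ : ℝ → ℝ) (r : ℝ) : BddBelow {s | 0 < s ∧ r ≤ Φ s} :=
  ⟨0, fun _ hs => hs.1.le⟩

theorem incInv_le {r s : ℝ} (hs : 0 < s) (h : r ≤ Φ s) : incInv Φ r ≤ s :=
  csInf_le (bddBelow_incInv Φ r) ⟨hs, h⟩

theorem WeakScaling.incInv_mono (hΦ : WeakScaling Φ α₁ α₂) : Monotone (incInv Φ) :=
  fun r r' h => csInf_le_csInf (bddBelow_incInv Φ r) (hΦ.exists_ge r')
    fun _ hs => ⟨hs.1, h.trans hs.2⟩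

theorem WeakScaling.incInv_pos (hΦ : WeakScaling Φ α₁ α₂) {r : ℝ} (hr : 0 < r) :
    0 < incInv Φ r := by
  have h1 := hΦ.pos one_pos
  -- This factor forces Φ(1/K) ≤ r/2, so by monotonicity every s with Φ(s) ≥ r is at least 1/K.
  obtain ⟨K, hK, h⟩ := hΦ.exists_scale (2 * Φ 1 / r)
  have hK0 : 0 < K := by linarith
  refine lt_of_lt_of_le (inv_pos.2 hK0) (le_csInf (hΦ.exists_ge r) fun s hs => ?_)
  by_contra hlt
  have h2 : Φ s ≤ Φ K⁻¹ := hΦ.monotoneOn hs.1 (inv_pos.2 hK0) (not_le.1 hlt).le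
  have h3 := h K⁻¹ (inv_pos.2 hK0)
  rw [mul_inv_cancel₀ hK0.ne', div_mul_eq_mul_div, div_le_iff₀ hr] at h3
  have h4 : r ≤ Φ K⁻¹ := hs.2.trans h2
  nlinarith

/-- Strict monotonicity suffices for this order of composition. In the other order Φ may jump over
r, so `Φ (incInv Φ r)` can differ from r. -/
theorem incInv_apply (hΦ : StrictMonoOn Φ (Ici 0)) {s : ℝ} (hs : 0 < s) : incInv Φ (Φ s) = s := by
  refine le_antisymm (incInv_le hs le_rfl) (le_csInf ⟨s, hs, le_rfl⟩ fun u hu => ?_)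
  exact (hΦ.le_iff_le hs.le (mem_Ici.2 hu.1.le)).1 hu.2

/-- Dilation by K maps the set whose infimum is Φ⁻¹(r) into the one for l r, so comparing infima
needs no continuity of Φ. -/
theorem WeakScaling.exists_incInv_mul_le (hΦ : WeakScaling Φ α₁ α₂) {l : ℝ} (hl : 0 ≤ l) :
    ∃ K : ℝ, 1 ≤ K ∧ ∀ r, incInv Φ (l * r) ≤ K * incInv Φ r := by
  obtain ⟨K, hK, h⟩ := hΦ.exists_scale l
  have hK0 : 0 < K := by linarith
  refine ⟨K, hK, fun r => ?_⟩
  rw [mul_comm K, ← div_le_iff₀ hK0]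
  refine le_csInf (hΦ.exists_ge r) fun s hs => ?_
  rw [div_le_iff₀ hK0, mul_comm s]
  exact incInv_le (mul_pos hK0 hs.1) ((mul_le_mul_of_nonneg_left hs.2 hl).trans (h s hs.1))

end Inverse

/-! ### Volume growth and doubling -/

section Volume

variable {M : Type*} [PseudoMetricSpace M] [MeasurableSpace M] {μ : Measure M} {d₁ d₂ : ℝ}
  {Φ : ℝ → ℝ} {α₁ α₂ : ℝ}

theorem vol_mono (μ : Measure M) (x : M) : Monotone (vol μ x) :=
  fun _ _ h => measure_mono (Metric.ball_subset_ball h)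

/-- `ENNReal.toReal` sends both 0 and ∞ to 0, so the positivity contained in weak scaling excludes
both. -/
theorem vol_ne_zero_and_ne_top (hV : UniformWeakScaling (fun (x : M) r => (vol μ x r).toReal) d₁ d₂)
    (x : M) {r : ℝ} (hr : 0 < r) : vol μ x r ≠ 0 ∧ vol μ x r ≠ ∞ := by
  obtain ⟨-, -, _, _, -, -, hw⟩ := hV
  have := ENNReal.toReal_pos_iff.1 ((hw x).pos r hr)
  exact ⟨this.1.ne', this.2.ne⟩

theorem exists_vol_mul_le (hV : UniformWeakScaling (fun (x : M) r => (vol μ x r).toReal) d₁ d₂)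
    {K : ℝ} (hK : 1 ≤ K) :
    ∃ D : ℝ≥0, 1 ≤ D ∧ ∀ (x : M) r, 0 < r → vol μ x (K * r) ≤ D * vol μ x r := by
  have hV' := hV
  obtain ⟨-, -, c₁, c₂, hc₁, hc₂, hw⟩ := hV
  refine ⟨max 1 (c₂ * K ^ d₂).toNNReal, le_max_left _ _, fun x r hr => ?_⟩
  have hKr : 0 < K * r := by positivity
  obtain ⟨h0, ht⟩ := vol_ne_zero_and_ne_top hV' x hr
  obtain ⟨-, ht'⟩ := vol_ne_zero_and_ne_top hV' x hKr
  have h1 := (hw x).upper r (K * r) hr (le_mul_of_one_le_left hr.le hK)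
  rw [mul_div_cancel_right₀ _ hr.ne', div_le_iff₀ (ENNReal.toReal_pos h0 ht)] at h1
  have hnn : 0 ≤ c₂ * K ^ d₂ := by positivity
  calc vol μ x (K * r) = ENNReal.ofReal (vol μ x (K * r)).toReal := (ENNReal.ofReal_toReal ht').symm
    _ ≤ ENNReal.ofReal (c₂ * K ^ d₂ * (vol μ x r).toReal) := ENNReal.ofReal_le_ofReal h1
    _ = ENNReal.ofReal (c₂ * K ^ d₂) * vol μ x r := by
        rw [ENNReal.ofReal_mul hnn, ENNReal.ofReal_toReal ht]
    _ ≤ _ := by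
        gcongr
        exact ENNReal.coe_le_coe.2 (le_max_right _ _)

theorem exists_vol_incInv_mul_le
    (hV : UniformWeakScaling (fun (x : M) r => (vol μ x r).toReal) d₁ d₂)
    (hΦ : WeakScaling Φ α₁ α₂) {l : ℝ} (hl : 0 ≤ l) :
    ∃ D : ℝ≥0, 1 ≤ D ∧ ∀ (x : M) r, 0 < r →
      vol μ x (incInv Φ (l * r)) ≤ D * vol μ x (incInv Φ r) := by
  obtain ⟨K, hK, h1⟩ := hΦ.exists_incInv_mul_le hl
  obtain ⟨D, hD, h2⟩ := exists_vol_mul_le hV hK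
  exact ⟨D, hD, fun x r hr => (vol_mono μ x (h1 r)).trans (h2 x _ (hΦ.incInv_pos hr))⟩

theorem antitone_one_div_vol_incInv (hΦ : WeakScaling Φ α₁ α₂) (μ : Measure M) (x : M) :
    Antitone fun r => 1 / vol μ x (incInv Φ r) :=
  fun _ _ h => ENNReal.div_le_div_left (vol_mono μ x (hΦ.incInv_mono h)) 1

/-- For l = 2 this is the doubling of h required by the comparison of integrals, with a constant
independent of x. -/
theorem exists_one_div_vol_incInv_le
    (hV : UniformWeakScaling (fun (x : M) r => (vol μ x r).toReal) d₁ d₂)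
    (hΦ : WeakScaling Φ α₁ α₂) {l : ℝ} (hl : 0 ≤ l) :
    ∃ D : ℝ≥0, 1 ≤ D ∧ ∀ (x : M) r, 0 < r →
      1 / vol μ x (incInv Φ r) ≤ D * (1 / vol μ x (incInv Φ (l * r))) := by
  obtain ⟨D, hD, h⟩ := exists_vol_incInv_mul_le hV hΦ hl
  refine ⟨D, hD, fun x r hr => ?_⟩
  have hD0 : (D : ℝ≥0∞) ≠ 0 := ENNReal.coe_ne_zero.2 (one_pos.trans_le hD).ne'
  calc 1 / vol μ x (incInv Φ r) = D * (1 / (D * vol μ x (incInv Φ r))) := by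
        rw [one_div, one_div, ENNReal.mul_inv (Or.inl hD0) (Or.inl ENNReal.coe_ne_top), ← mul_assoc,
          ENNReal.mul_inv_cancel hD0 ENNReal.coe_ne_top, one_mul]
    _ ≤ _ := by
        gcongr
        exact h x r hr

end Volume

/-! ### The two regimes of the jump bound -/

section JumpBound

variable {M : Type*} [MetricSpace M] [MeasurableSpace M] {μ : Measure M} {d₁ d₂ : ℝ}
  {Φ : ℝ → ℝ} {α₁ α₂ : ℝ}

/-- Near the diagonal, `Φ(d(x,y)) ≤ N r`, the jump bound is comparable to `1/V(x,Φ⁻¹(r))`. -/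
theorem exists_one_div_vol_le_jumpBound
    (hV : UniformWeakScaling (fun (x : M) r => (vol μ x r).toReal) d₁ d₂)
    (hΦ : WeakScaling Φ α₁ α₂) (hΦm : StrictMonoOn Φ (Ici 0)) {N : ℝ} (hN : 1 ≤ N) :
    ∃ c : ℝ≥0, 0 < c ∧ ∀ (x y : M) r, 0 < r → Φ (dist x y) / N ≤ r →
      c * (1 / vol μ x (incInv Φ r)) ≤ jumpBound μ Φ r x y := by
  have hN0 : 0 < N := by linarith
  obtain ⟨D, hD, h⟩ := exists_vol_incInv_mul_le hV hΦ hN0.le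
  have hD0 : 0 < D := one_pos.trans_le hD
  have hN0' : 0 < N.toNNReal := Real.toNNReal_pos.2 hN0
  have hDN : (((D * N.toNNReal)⁻¹ : ℝ≥0) : ℝ≥0∞) * (D * ENNReal.ofReal N) = 1 := by
    rw [ENNReal.ofReal, ← ENNReal.coe_mul, ← ENNReal.coe_mul, inv_mul_cancel₀ (by positivity),
      ENNReal.coe_one]
  refine ⟨(D * N.toNNReal)⁻¹, by positivity, fun x y r hr hxy => ?_⟩
  obtain ⟨hv0, hvt⟩ := vol_ne_zero_and_ne_top hV x (hΦ.incInv_pos hr)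
  refine le_min ?_ ?_
  · refine mul_le_of_le_one_left zero_le ?_
    rw [← ENNReal.coe_one, ENNReal.coe_le_coe]
    refine inv_le_one_of_one_le₀ (one_le_mul hD ?_)
    rwa [Real.one_le_toNNReal]
  · have hr0 : ENNReal.ofReal r ≠ 0 := by simpa using hr
    rw [ENNReal.le_div_iff_mul_le (Or.inr hr0) (Or.inr ENNReal.ofReal_ne_top)]
    have h1 : Φ (dist x y) ≤ N * r := by rwa [div_le_iff₀ hN0, mul_comm] at hxy
    have h2 : vol μ x (dist x y) ≤ D * vol μ x (incInv Φ r) := by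
      -- On the diagonal the ball of radius 0 is empty; off it, d = Φ⁻¹(Φ(d)) ≤ Φ⁻¹(N r), and volume
      -- doubling removes N.
      rcases (dist_nonneg (x := x) (y := y)).eq_or_lt with h0 | h0
      · simp [← h0, vol]
      · refine le_trans (vol_mono μ x ?_) (h x r hr)
        rw [← incInv_apply hΦm h0]
        exact hΦ.incInv_mono h1
    calc _ ≤ (((D * N.toNNReal)⁻¹ : ℝ≥0) : ℝ≥0∞) * (1 / vol μ x (incInv Φ r)) *
          (D * vol μ x (incInv Φ r) * (ENNReal.ofReal N * ENNReal.ofReal r)) := by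
          rw [← ENNReal.ofReal_mul hN0.le]
          gcongr
      _ = (((D * N.toNNReal)⁻¹ : ℝ≥0) : ℝ≥0∞) * (D * ENNReal.ofReal N) *
          ((vol μ x (incInv Φ r))⁻¹ * vol μ x (incInv Φ r)) * ENNReal.ofReal r := by
          rw [one_div]; ring
      _ = ENNReal.ofReal r := by rw [hDN, ENNReal.inv_mul_cancel hv0 hvt, one_mul, one_mul]

/-- For `r ≤ Φ(d(x,y))`, the second term of the jump bound is at most `1/V(x,d(x,y))`. -/
theorem div_vol_mul_le_one_div (μ : Measure M) (hΦ : WeakScaling Φ α₁ α₂) {x y : M} (hxy : x ≠ y)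
    {r : ℝ} (hrd : r ≤ Φ (dist x y)) :
    ENNReal.ofReal r / (vol μ x (dist x y) * ENNReal.ofReal (Φ (dist x y))) ≤
      1 / vol μ x (dist x y) := by
  have hd := dist_pos.2 hxy
  have h0 : ENNReal.ofReal (Φ (dist x y)) ≠ 0 := by simpa using hΦ.pos hd
  calc _ ≤ ENNReal.ofReal (Φ (dist x y)) /
        (vol μ x (dist x y) * ENNReal.ofReal (Φ (dist x y))) := by gcongr
    _ = 1 / vol μ x (dist x y) := by
      rw [div_eq_mul_inv, ENNReal.mul_inv (Or.inr ENNReal.ofReal_ne_top) (Or.inr h0), mul_comm,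
        mul_assoc, ENNReal.inv_mul_cancel h0 ENNReal.ofReal_ne_top, mul_one, one_div]

/-- Away from the diagonal, the jump bound equals its second term. -/
theorem jumpBound_eq_of_le (μ : Measure M) (hΦ : WeakScaling Φ α₁ α₂)
    {x y : M} (hxy : x ≠ y) {r : ℝ} (hrd : r ≤ Φ (dist x y)) :
    jumpBound μ Φ r x y =
      ENNReal.ofReal r / (vol μ x (dist x y) * ENNReal.ofReal (Φ (dist x y))) := by
  refine min_eq_right ((div_vol_mul_le_one_div μ hΦ hxy hrd).trans ?_)
  -- Since Φ⁻¹(r) ≤ d, the value 1/V(x,d) separates the two terms of the minimum.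
  exact ENNReal.div_le_div_left (vol_mono μ x (incInv_le (dist_pos.2 hxy) hrd)) 1

end JumpBound

/-! ### Integrals against the passage-time law -/

section Comparison

variable {m : Measure ℝ} [SFinite m] {h j : ℝ → ℝ≥0∞} {f : ℝ≥0∞} {a g : ℝ}

theorem ofReal_sub_mul_le_setLIntegral_Ioc (hh : Antitone h) (a b : ℝ) :
    ENNReal.ofReal (b - a) * h b ≤ ∫⁻ r in Ioc a b, h r := by
  calc ENNReal.ofReal (b - a) * h b = ∫⁻ _ in Ioc a b, h b := by
        rw [setLIntegral_const, Real.volume_Ioc, mul_comm]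
    _ ≤ _ := setLIntegral_mono' measurableSet_Ioc fun r hr => hh hr.2

/-- The pieces (0,a], (a,g] and (g,∞) contribute 2, 4 and 1 to the constant 7. On the outer two a
single value, h(a) or h(g), times the mass is absorbed by doubling into the integral of h over
(a,2a] or (g,2g]; the middle one is the Tonelli comparison. -/
theorem lintegral_Ioi_le_mul_volume (hh : Antitone h) {D : ℝ≥0∞}
    (hD : ∀ u, 0 < u → h u ≤ D * h (2 * u))
    (hm : ∀ r, 0 < r → m (Ioc 0 r) ≤ 2 * f * ENNReal.ofReal r) (hm1 : m (Ioi g) ≤ 1)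
    (ha : 0 ≤ a) (hag : a ≤ g) (hg : 0 < g) (hfg : f * ENNReal.ofReal g = 1)
    (hj : ∀ r, 0 < r → j r ≤ h r) (hja : ∀ r, 0 < r → r ≤ a → j r ≤ h a) :
    ∫⁻ r in Ioi 0, j r ∂m ≤ 7 * D * (f * ∫⁻ r in Ioc a (2 * g), h r) := by
  set I := ∫⁻ r in Ioc a (2 * g), h r with hI
  have hA : ∫⁻ r in Ioc 0 a, j r ∂m ≤ 2 * D * (f * I) := by
    rcases ha.eq_or_lt with rfl | ha0
    · simp
    calc ∫⁻ r in Ioc 0 a, j r ∂m ≤ ∫⁻ _ in Ioc 0 a, h a ∂m :=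
          setLIntegral_mono' measurableSet_Ioc fun r hr => hja r hr.1 hr.2
      _ = h a * m (Ioc 0 a) := by rw [setLIntegral_const]
      _ ≤ D * h (2 * a) * (2 * f * ENNReal.ofReal (2 * a - a)) := by
          gcongr
          · exact hD a ha0
          · rw [show 2 * a - a = a by ring]
            exact hm a ha0
      _ = 2 * D * (f * (ENNReal.ofReal (2 * a - a) * h (2 * a))) := by ring
      _ ≤ 2 * D * (f * ∫⁻ r in Ioc a (2 * a), h r) := by
          gcongr
          exact ofReal_sub_mul_le_setLIntegral_Ioc hh _ _
      _ ≤ _ := by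
          gcongr
          exact lintegral_mono_set (Ioc_subset_Ioc_right (by linarith))
  have hB : ∫⁻ r in Ioc a g, j r ∂m ≤ 4 * D * (f * I) := by
    calc ∫⁻ r in Ioc a g, j r ∂m ≤ ∫⁻ r in Ioc a g, h r ∂m :=
          setLIntegral_mono' measurableSet_Ioc fun r hr => hj r (ha.trans_lt hr.1)
      _ ≤ 2 * D * (2 * f) * I := setLIntegral_antitone_le_volume hh hD hm ha
      _ = _ := by ring
  have hC : ∫⁻ r in Ioi g, j r ∂m ≤ D * (f * I) := by
    calc ∫⁻ r in Ioi g, j r ∂m ≤ ∫⁻ _ in Ioi g, h g ∂m :=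
          setLIntegral_mono' measurableSet_Ioi fun r hr =>
            (hj r (hg.trans hr)).trans (hh (le_of_lt hr))
      _ = h g * m (Ioi g) := by rw [setLIntegral_const]
      _ ≤ D * h (2 * g) * 1 := by
          gcongr
          exact hD g hg
      _ = D * (f * (ENNReal.ofReal (2 * g - g) * h (2 * g))) := by
          rw [show 2 * g - g = g by ring, ← mul_assoc f, hfg]; ring
      _ ≤ D * (f * ∫⁻ r in Ioc g (2 * g), h r) := by
          gcongr
          exact ofReal_sub_mul_le_setLIntegral_Ioc hh _ _
      _ ≤ _ := by
          gcongr
          exact lintegral_mono_set (Ioc_subset_Ioc_left hag)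
  have hset : Ioi (0 : ℝ) = Ioc 0 a ∪ Ioc a g ∪ Ioi g := by
    rw [Ioc_union_Ioc_eq_Ioc ha hag, Ioc_union_Ioi_eq_Ioi (ha.trans hag)]
  calc ∫⁻ r in Ioi 0, j r ∂m
      ≤ ∫⁻ r in Ioc 0 a, j r ∂m + ∫⁻ r in Ioc a g, j r ∂m + ∫⁻ r in Ioi g, j r ∂m := by
        rw [hset]
        refine (lintegral_union_le _ _ _).trans ?_
        gcongr
        exact lintegral_union_le _ _ _
    _ ≤ 2 * D * (f * I) + 4 * D * (f * I) + D * (f * I) := by gcongr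
    _ = _ := by ring

/-- The windows (r/N,r] with r just above a reach down to a/N, so the kernel must be comparable to h
for all r > a/N, not only for r > a. -/
theorem mul_volume_le_setLIntegral (hh : Antitone h) {c : ℝ≥0∞} {N : ℝ} (hN : 1 ≤ N)
    (hm : ∀ r, 0 < r → r ≤ g → c * f * ENNReal.ofReal r ≤ m (Ioc (r / N) r))
    (ha : 0 ≤ a) (hag : a ≤ g) (hg : 0 < g) :
    c * (f * ∫⁻ r in Ioc a (2 * g), h r) ≤
      ENNReal.ofReal (N + 1) * ∫⁻ r in Ioc (a / N) g, h r ∂m := by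
  have hA := setLIntegral_volume_le_antitone hh hN hm ha
  -- The mass bound is unavailable beyond g; there h ≤ h(g), and the single window at g pays for the
  -- whole piece. This is the 1 in N + 1.
  have hB : c * f * ∫⁻ r in Ioc g (2 * g), h r ≤ ∫⁻ r in Ioc (a / N) g, h r ∂m := by
    calc c * f * ∫⁻ r in Ioc g (2 * g), h r ≤ c * f * ∫⁻ _ in Ioc g (2 * g), h g := by
          gcongr 1
          exact setLIntegral_mono' measurableSet_Ioc fun r hr => hh hr.1.le
      _ = h g * (c * f * ENNReal.ofReal g) := by
          rw [setLIntegral_const, Real.volume_Ioc, show 2 * g - g = g by ring]; ring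
      _ ≤ h g * m (Ioc (g / N) g) := by
          gcongr
          exact hm g hg le_rfl
      _ = ∫⁻ _ in Ioc (g / N) g, h g ∂m := by rw [setLIntegral_const]
      _ ≤ ∫⁻ r in Ioc (g / N) g, h r ∂m :=
          setLIntegral_mono' measurableSet_Ioc fun r hr => hh hr.2
      _ ≤ _ := lintegral_mono_set (Ioc_subset_Ioc_left (by gcongr))
  calc c * (f * ∫⁻ r in Ioc a (2 * g), h r)
      ≤ c * (f * ((∫⁻ r in Ioc a g, h r) + ∫⁻ r in Ioc g (2 * g), h r)) := by
        gcongr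
        rw [← Ioc_union_Ioc_eq_Ioc hag (by linarith : g ≤ 2 * g)]
        exact lintegral_union_le _ _ _
    _ = c * f * (∫⁻ r in Ioc a g, h r) + c * f * ∫⁻ r in Ioc g (2 * g), h r := by ring
    _ ≤ ENNReal.ofReal N * ∫⁻ r in Ioc (a / N) g, h r ∂m + ∫⁻ r in Ioc (a / N) g, h r ∂m := by
        gcongr
    _ = _ := by
        rw [ENNReal.ofReal_add (by linarith) zero_le_one, ENNReal.ofReal_one]; ring

end Comparison

end TimeFractional

/-! ### Two-sided estimates of the fundamental solution -/

theorem theorem1p3 {M Ω Ω' : Type*}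
    [MetricSpace M] [LocallyCompactSpace M] [TopologicalSpace.SeparableSpace M]
    [MeasurableSpace M] [BorelSpace M]
    (μ : Measure M) [μ.Regular] [μ.IsOpenPosMeasure]
    (d₁ d₂ : ℝ)
    (hV : TimeFractional.UniformWeakScaling (fun (x : M) r => (TimeFractional.vol μ x r).toReal)
      d₁ d₂)
    -- the subordinator
    [MeasurableSpace Ω'] (P' : Measure Ω') [IsProbabilityMeasure P']
    (S : ℝ≥0 → Ω' → ℝ) (hS : TimeFractional.IsSubordinator S P')
    (φ : ℝ → ℝ) (hφ : TimeFractional.IsLaplaceExponent S P' φ)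
    (ν : Measure ℝ) (hν : TimeFractional.IsDriftlessExponent φ ν)
    (β₁ β₂ : ℝ) (hβ₂ : β₂ < 1) (hφs : TimeFractional.WeakScaling φ β₁ β₂)
    -- the strong Markov process and its heat kernel
    {mΩ : MeasurableSpace Ω} (ℱ : Filtration ℝ≥0 mΩ) (X : ℝ≥0 → Ω → M) (P : M → Measure Ω)
    (hX : TimeFractional.IsStrongMarkov ℱ X P)
    (q : ℝ → M → M → ℝ≥0∞) (hq : TimeFractional.IsTransitionDensity X P μ q)
    (Φ : ℝ → ℝ) (hΦ0 : Φ 0 = 0) (hΦmono : StrictMonoOn Φ (Ici 0))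
    (α₁ α₂ : ℝ) (hΦs : TimeFractional.WeakScaling Φ α₁ α₂)
    (hqΦ : ∃ c₁ c₂ : ℝ≥0, 0 < c₁ ∧ 0 < c₂ ∧ ∀ (t : ℝ) (x y : M), 0 < t →
      c₁ * TimeFractional.jumpBound μ Φ t x y ≤ q t x y ∧
        q t x y ≤ c₂ * TimeFractional.jumpBound μ Φ t x y) :
    (∃ c₁ c₂ : ℝ≥0, 0 < c₁ ∧ 0 < c₂ ∧ ∀ (t : ℝ) (x y : M), 0 < t →
      Φ (dist x y) * φ t⁻¹ ≤ 1 →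
        c₁ * (ENNReal.ofReal (φ t⁻¹) *
            ∫⁻ r in Ioc (Φ (dist x y)) (2 / φ t⁻¹),
              1 / TimeFractional.vol μ x (TimeFractional.incInv Φ r)) ≤
          hS.fundamentalSolution q t x y ∧
        hS.fundamentalSolution q t x y ≤
          c₂ * (ENNReal.ofReal (φ t⁻¹) *
            ∫⁻ r in Ioc (Φ (dist x y)) (2 / φ t⁻¹),
              1 / TimeFractional.vol μ x (TimeFractional.incInv Φ r)) ∧
        ENNReal.ofReal (φ t⁻¹) *
            ∫⁻ r in Ioc (Φ (dist x y)) (2 / φ t⁻¹),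
              1 / TimeFractional.vol μ x (TimeFractional.incInv Φ r) =
          ∫⁻ r in Ioc (Φ (dist x y) * φ t⁻¹) 2,
            1 / TimeFractional.vol μ x (TimeFractional.incInv Φ (r / φ t⁻¹))) ∧
    (∃ c₁ c₂ : ℝ≥0, 0 < c₁ ∧ 0 < c₂ ∧ ∀ (t : ℝ) (x y : M), 0 < t →
      1 ≤ Φ (dist x y) * φ t⁻¹ →
        c₁ * (1 / (ENNReal.ofReal (φ t⁻¹) * TimeFractional.vol μ x (dist x y) *
            ENNReal.ofReal (Φ (dist x y)))) ≤
          hS.fundamentalSolution q t x y ∧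
        hS.fundamentalSolution q t x y ≤
          c₂ * (1 / (ENNReal.ofReal (φ t⁻¹) * TimeFractional.vol μ x (dist x y) *
            ENNReal.ofReal (Φ (dist x y))))) := by
  obtain ⟨q₁, q₂, hq₁, hq₂, hqb⟩ := hqΦ
  obtain ⟨c, N, hc, hN, hmlow⟩ := hS.exists_le_measure_Ioc hφ hβ₂ hφs
  obtain ⟨D, hD1, hD⟩ := TimeFractional.exists_one_div_vol_incInv_le hV hΦs zero_le_two
  obtain ⟨k, hk, hkj⟩ := TimeFractional.exists_one_div_vol_le_jumpBound hV hΦs hΦmono hN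
  have hN0 : 0 < N := by linarith
  have hc' : 0 < c.toNNReal := Real.toNNReal_pos.2 hc
  have hN' : 0 < N.toNNReal := Real.toNNReal_pos.2 hN0
  have hN1' : 0 < (N + 1).toNNReal := Real.toNNReal_pos.2 (by linarith)
  have hNinv : (((N + 1).toNNReal⁻¹ : ℝ≥0) : ℝ≥0∞) * ENNReal.ofReal (N + 1) = 1 := by
    rw [ENNReal.ofReal, ← ENNReal.coe_mul, inv_mul_cancel₀ hN1'.ne', ENNReal.coe_one]
  have hD0 : 0 < D := one_pos.trans_le hD1
  have hΦnn : ∀ x y : M, 0 ≤ Φ (dist x y) := fun x y => by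
    rw [← hΦ0]
    exact hΦmono.monotoneOn (mem_Ici.2 le_rfl) (mem_Ici.2 dist_nonneg) dist_nonneg
  have hmlow' : ∀ t r, 0 < t → 0 < r → r ≤ 1 / φ t⁻¹ →
      ENNReal.ofReal c * ENNReal.ofReal (φ t⁻¹) * ENNReal.ofReal r ≤
        (hS.tailFunction t).measure (Ioc (r / N) r) := fun t r ht hr hrg =>
    hmlow t r ht hr ((le_div_iff₀ (hφs.pos (inv_pos.2 ht))).1 hrg)
  have hfg : ∀ t, 0 < t → ENNReal.ofReal (φ t⁻¹) * ENNReal.ofReal (1 / φ t⁻¹) = 1 := by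
    intro t ht
    have hf := hφs.pos (inv_pos.2 ht)
    rw [← ENNReal.ofReal_mul hf.le, mul_one_div_cancel hf.ne', ENNReal.ofReal_one]
  constructor
  · refine ⟨q₁ * k * (c.toNNReal / (N + 1).toNNReal), q₂ * (7 * D), by positivity, by positivity,
      fun t x y ht hxy => ?_⟩
    have hf : 0 < φ t⁻¹ := hφs.pos (inv_pos.2 ht)
    have hg : 0 < 1 / φ t⁻¹ := by positivity
    have hag : Φ (dist x y) ≤ 1 / φ t⁻¹ := (le_div_iff₀ hf).2 hxy
    have hh := TimeFractional.antitone_one_div_vol_incInv hΦs μ x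
    refine ⟨?_, ?_, TimeFractional.ofReal_mul_setLIntegral_Ioc _ hf _ _⟩
    · have hlow := TimeFractional.mul_volume_le_setLIntegral hh hN
        (fun r hr hrg => hmlow' t r ht hr hrg) (hΦnn x y) hag hg
      rw [mul_one_div] at hlow
      calc _ = (q₁ : ℝ≥0∞) * k * (((N + 1).toNNReal⁻¹ : ℝ≥0) : ℝ≥0∞) * (ENNReal.ofReal c *
            (ENNReal.ofReal (φ t⁻¹) * ∫⁻ r in Ioc (Φ (dist x y)) (2 / φ t⁻¹),
              1 / TimeFractional.vol μ x (TimeFractional.incInv Φ r))) := by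
            rw [div_eq_mul_inv]; push_cast [ENNReal.ofReal]; ring
        _ ≤ (q₁ : ℝ≥0∞) * k * (((N + 1).toNNReal⁻¹ : ℝ≥0) : ℝ≥0∞) * (ENNReal.ofReal (N + 1) *
            ∫⁻ r in Ioc (Φ (dist x y) / N) (1 / φ t⁻¹),
              1 / TimeFractional.vol μ x (TimeFractional.incInv Φ r)
              ∂(hS.tailFunction t).measure) := by gcongr
        _ = (q₁ : ℝ≥0∞) * k * ∫⁻ r in Ioc (Φ (dist x y) / N) (1 / φ t⁻¹),
              1 / TimeFractional.vol μ x (TimeFractional.incInv Φ r)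
              ∂(hS.tailFunction t).measure := by
            rw [mul_assoc ((q₁ : ℝ≥0∞) * k), ← mul_assoc _ (ENNReal.ofReal (N + 1)), hNinv, one_mul]
        _ = ∫⁻ r in Ioc (Φ (dist x y) / N) (1 / φ t⁻¹),
              q₁ * (k * (1 / TimeFractional.vol μ x (TimeFractional.incInv Φ r)))
              ∂(hS.tailFunction t).measure := by
            rw [lintegral_const_mul' _ _ ENNReal.coe_ne_top,
              lintegral_const_mul' _ _ ENNReal.coe_ne_top, mul_assoc]
        _ ≤ ∫⁻ r in Ioc (Φ (dist x y) / N) (1 / φ t⁻¹), q r x y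
              ∂(hS.tailFunction t).measure := by
            refine setLIntegral_mono' measurableSet_Ioc fun r hr => ?_
            have hr0 : 0 < r := lt_of_le_of_lt (div_nonneg (hΦnn x y) hN0.le) hr.1
            refine le_trans ?_ (hqb r x y hr0).1
            gcongr
            exact hkj x y r hr0 hr.1.le
        _ ≤ _ := lintegral_mono_set fun r hr =>
            lt_of_le_of_lt (div_nonneg (hΦnn x y) hN0.le) hr.1
    · have hup := TimeFractional.lintegral_Ioi_le_mul_volume
        (m := (hS.tailFunction t).measure) (j := fun r => TimeFractional.jumpBound μ Φ r x y)
        hh (hD x) (fun r hr => hS.measure_Ioc_le hφ ht hr.le hf.le)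
        (hS.measure_Ioi_le_one t _) (hΦnn x y) hag hg (hfg t ht)
        (fun r _ => min_le_left _ _) (fun r hr hra => by
          -- On the diagonal (0,Φ(d)] is empty because Φ(0) = 0. Off it, h(Φ(d)) = 1/V(x,d).
          have hne : x ≠ y := by
            rintro rfl
            rw [dist_self, hΦ0] at hra
            linarith
          simp only [TimeFractional.incInv_apply hΦmono (dist_pos.2 hne)]
          exact (min_le_right _ _).trans (TimeFractional.div_vol_mul_le_one_div μ hΦs hne hra))
      rw [mul_one_div] at hup
      calc hS.fundamentalSolution q t x y
          ≤ ∫⁻ r in Ioi 0, q₂ * TimeFractional.jumpBound μ Φ r x y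
              ∂(hS.tailFunction t).measure :=
            setLIntegral_mono' measurableSet_Ioi fun r hr => (hqb r x y hr).2
        _ = q₂ * ∫⁻ r in Ioi 0, TimeFractional.jumpBound μ Φ r x y
              ∂(hS.tailFunction t).measure := lintegral_const_mul' _ _ ENNReal.coe_ne_top
        _ ≤ q₂ * (7 * D * (ENNReal.ofReal (φ t⁻¹) *
              ∫⁻ r in Ioc (Φ (dist x y)) (2 / φ t⁻¹),
                1 / TimeFractional.vol μ x (TimeFractional.incInv Φ r))) := by gcongr
        _ = _ := by push_cast; ring
  · refine ⟨q₁ * (c.toNNReal / N.toNNReal), q₂ * (Real.exp 1).toNNReal, by positivity,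
      mul_pos hq₂ (Real.toNNReal_pos.2 (Real.exp_pos 1)), fun t x y ht hxy => ?_⟩
    have hf : 0 < φ t⁻¹ := hφs.pos (inv_pos.2 ht)
    have hg : 0 < 1 / φ t⁻¹ := by positivity
    have hne : x ≠ y := by
      rintro rfl
      rw [dist_self, hΦ0] at hxy
      linarith
    have hga : 1 / φ t⁻¹ ≤ Φ (dist x y) := (div_le_iff₀ hf).2 hxy
    obtain ⟨hv0, hvt⟩ := TimeFractional.vol_ne_zero_and_ne_top hV x (dist_pos.2 hne)
    have ha0 : ENNReal.ofReal (Φ (dist x y)) ≠ 0 := by simpa using hΦs.pos (dist_pos.2 hne)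
    have hf0 : ENNReal.ofReal (φ t⁻¹) ≠ 0 := by simpa using hf
    set W := TimeFractional.vol μ x (dist x y) * ENNReal.ofReal (Φ (dist x y)) with hW
    have hW0 : W ≠ 0 := mul_ne_zero hv0 ha0
    have hinv : 1 / (ENNReal.ofReal (φ t⁻¹) * TimeFractional.vol μ x (dist x y) *
        ENNReal.ofReal (Φ (dist x y))) = (ENNReal.ofReal (φ t⁻¹))⁻¹ * W⁻¹ := by
      rw [mul_assoc, ← hW, one_div,
        ENNReal.mul_inv (Or.inl hf0) (Or.inl ENNReal.ofReal_ne_top)]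
    rw [hinv]
    constructor
    -- At r = g the mass bound is just c, and on (g/N,g] the kernel is at least q₁ (g/N)/W.
    · have hm := hmlow' t _ ht hg le_rfl
      rw [mul_assoc, hfg t ht, mul_one] at hm
      have hgN : ENNReal.ofReal (1 / φ t⁻¹ / N) =
          (ENNReal.ofReal (φ t⁻¹))⁻¹ * ((N.toNNReal⁻¹ : ℝ≥0) : ℝ≥0∞) := by
        rw [ENNReal.coe_inv hN'.ne', ← ENNReal.ofReal, ← ENNReal.ofReal_inv_of_pos hf,
          ← ENNReal.ofReal_inv_of_pos hN0, ← ENNReal.ofReal_mul (by positivity)]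
        congr 1
        field_simp
      calc _ = q₁ * (ENNReal.ofReal (1 / φ t⁻¹ / N) / W) * ENNReal.ofReal c := by
            rw [hgN, div_eq_mul_inv, div_eq_mul_inv]; push_cast [ENNReal.ofReal]; ring
        _ ≤ q₁ * (ENNReal.ofReal (1 / φ t⁻¹ / N) / W) *
            (hS.tailFunction t).measure (Ioc (1 / φ t⁻¹ / N) (1 / φ t⁻¹)) := by gcongr
        _ = ∫⁻ _ in Ioc (1 / φ t⁻¹ / N) (1 / φ t⁻¹),
            q₁ * (ENNReal.ofReal (1 / φ t⁻¹ / N) / W) ∂(hS.tailFunction t).measure := by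
            rw [setLIntegral_const]
        _ ≤ ∫⁻ r in Ioc (1 / φ t⁻¹ / N) (1 / φ t⁻¹), q r x y
              ∂(hS.tailFunction t).measure := by
            refine setLIntegral_mono' measurableSet_Ioc fun r hr => ?_
            have hr0 : 0 < r := lt_of_le_of_lt (div_nonneg hg.le hN0.le) hr.1
            refine le_trans ?_ (hqb r x y hr0).1
            rw [TimeFractional.jumpBound_eq_of_le μ hΦs hne (hr.2.trans hga), ← hW]
            gcongr
            exact hr.1.le
        _ ≤ _ := lintegral_mono_set fun r hr =>
            lt_of_le_of_lt (div_nonneg hg.le hN0.le) hr.1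
    -- The second term of the minimum bounds the kernel for every r, also beyond Φ(d), so the mean
    -- of the passage time decides without splitting the integral.
    · calc hS.fundamentalSolution q t x y
          ≤ ∫⁻ r in Ioi 0, q₂ * (W⁻¹ * ENNReal.ofReal r) ∂(hS.tailFunction t).measure := by
            refine setLIntegral_mono' measurableSet_Ioi fun r hr => ?_
            refine (hqb r x y hr).2.trans ?_
            gcongr
            rw [mul_comm, ← div_eq_mul_inv]
            exact min_le_right _ _
        _ = q₂ * (W⁻¹ * ∫⁻ r in Ioi 0, ENNReal.ofReal r ∂(hS.tailFunction t).measure) := by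
            rw [lintegral_const_mul' _ _ ENNReal.coe_ne_top,
              lintegral_const_mul' _ _ (ENNReal.inv_ne_top.2 hW0)]
        _ ≤ q₂ * (W⁻¹ * (ENNReal.ofReal (Real.exp 1) / ENNReal.ofReal (φ t⁻¹))) := by
            gcongr
            exact hS.lintegral_id_le hφ ht hf
        _ = _ := by rw [div_eq_mul_inv]; push_cast [ENNReal.ofReal]; ring
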